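/- **Setting.** Let $\mathcal M_d$ be the complex $d\times d$ matrices. The target is a (possibly degenerate) von Neumann measurement with $m\ge 1$ outcomes on $\mathbb C^d$, i.e. mutually orthogonal, non-zero orthogonal projections $Q_1,\dots,Q_m\in\mathcal M_d$ (of arbitrary ranks) with $\sum_i Q_i=\mathbb 1$. An instrument with $m$ outcomes is a tuple $I=(I_1,\dots,I_m)$ of completely positive linear maps $I_i:\mathcal M_d\to\mathcal M_d$ whose sum $\sum_i I_i$ is trace preserving. Put $E_i':=I_i^*(\mathbb 1)$, where $I_i^*$ is the adjoint with respect to the Hilbert–Schmidt inner product, and define $$\delta_{TV}(I):=\sup_{\rho}\ \frac12\sum_{i=1}^m\big|\operatorname{tr}(E_i'\rho)-\operatorname{tr}(Q_i\rho)\big|,\qquad \Delta_\diamond(I):=\Big\|\sum_{i=1}^m I_i-\mathrm{id}\Big\|_\diamond ,\qquad \|\Phi\|_\diamond:=\sup_{\sigma}\big\|(\Phi\otimes \mathrm{id}_d)(\sigma)\big\|_1 ,$$ where $\rho$ runs over the density operators on $\mathbb C^d$, $\sigma$ over those on $\mathbb C^d\otimes\mathbb C^d$, and $\|\cdot\|_1$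 is the trace norm. For $D\in\mathbb R$ let $$\tau_m(D):=\begin{cases}\dfrac1{2m}\Big(\sqrt{(2-D)(m-1)}-\sqrt{D}\Big)^2 & \text{if } D\le 2-\frac2m,\\[2mm] 0 & \text{if } D>2-\frac2m .\end{cases}$$ **Theorem (Total variation – diamond norm tradeoff).** For every such target measurement: 1. Every instrument $I$ with $m$ outcomes on $\mathbb C^d$ satisfies $\delta_{TV}(I)\ \ge\ \tau_m\big(\Delta_\diamond(I)\big)$. 2. The inequality is tight along the whole curve: for every $D\in[0,2]$ (only $D=0$ if $d=1$, where the identity is the only channel) there is an instrument $I$ with $m$ outcomes on $\mathbb C^d$ such that $\Delta_\diamond(I)=D$ and $\delta_{TV}(I)=\tau_m(D)$. In particular, the optimal tradeoff depends only on the number $m$ of outcomes, not on $d$ or on the ranks of the $Q_i$. -/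

import Mathlib

open scoped Kronecker Matrix ComplexOrder

noncomputable section

namespace QTradeoff

/-- The algebra of complex `d × d` matrices. -/
abbrev Mat (d : ℕ) : Type := Matrix (Fin d) (Fin d) ℂ

/-- Density operators: positive semidefinite matrices of trace one. -/
structure IsDensity {n : Type*} [Fintype n] (ρ : Matrix n n ℂ) : Prop where
  posSemidef : ρ.PosSemidef
  trace_eq_one : ρ.trace = 1

/-- A von Neumann measurement with `m` outcomes on `ℂ^d`, possibly degenerate: mutually orthogonal
non-zero orthogonal projections (of arbitrary ranks) that sum up to the identity. -/
structure IsVonNeumannMeasurement {d m : ℕ} (Q : Fin m → Mat d) : Prop where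
  isStarProjection : ∀ i, IsStarProjection (Q i)
  orthogonal : ∀ i j, i ≠ j → Q i * Q j = 0
  ne_zero : ∀ i, Q i ≠ 0
  sum_eq_one : ∑ i, Q i = 1

/-- The map `Φ ⊗ id_k`; on a matrix `X`, regarded as a `k × k` block matrix with `d × d` blocks
(the block index being the second tensor factor), `Φ` acts on every block. -/
def tensorId {d : ℕ} (Φ : Mat d →ₗ[ℂ] Mat d) (k : ℕ) :
    Matrix (Fin d × Fin k) (Fin d × Fin k) ℂ →ₗ[ℂ] Matrix (Fin d × Fin k) (Fin d × Fin k) ℂ where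
  toFun X := Matrix.of fun p q => Φ (Matrix.of fun i j => X (i, p.2) (j, q.2)) p.1 q.1
  map_add' X Y := by
    ext p q
    exact congrFun (congrFun (Φ.map_add (Matrix.of fun i j => X (i, p.2) (j, q.2))
      (Matrix.of fun i j => Y (i, p.2) (j, q.2))) p.1) q.1
  map_smul' c X := by
    ext p q
    exact congrFun (congrFun (Φ.map_smul c (Matrix.of fun i j => X (i, p.2) (j, q.2))) p.1) q.1

theorem tensorId_kronecker {d : ℕ} (Φ : Mat d →ₗ[ℂ] Mat d) (k : ℕ) (A : Mat d) (B : Mat k) :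
    tensorId Φ k (A ⊗ₖ B) = Φ A ⊗ₖ B := by
  ext p q
  have h : (Matrix.of fun i j => (A ⊗ₖ B) (i, p.2) (j, q.2)) = B p.2 q.2 • A := by
    ext i j
    simp [Matrix.kroneckerMap_apply, mul_comm]
  change Φ (Matrix.of fun i j => (A ⊗ₖ B) (i, p.2) (j, q.2)) p.1 q.1 = _
  rw [h, map_smul]
  simp [Matrix.kroneckerMap_apply, mul_comm]

/-- Complete positivity: `Φ ⊗ id_k` preserves positive semidefiniteness for every `k`. -/
def IsCompletelyPositive {d : ℕ} (Φ : Mat d →ₗ[ℂ] Mat d) : Prop :=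
  ∀ (k : ℕ) (X : Matrix (Fin d × Fin k) (Fin d × Fin k) ℂ),
    X.PosSemidef → (tensorId Φ k X).PosSemidef

/-- An instrument with `m` outcomes on `ℂ^d`: completely positive maps `I i` whose sum is
trace preserving. -/
structure IsInstrument {d m : ℕ} (I : Fin m → (Mat d →ₗ[ℂ] Mat d)) : Prop where
  completelyPositive : ∀ i, IsCompletelyPositive (I i)
  tracePreserving : ∀ ρ : Mat d, ((∑ i, I i) ρ).trace = ρ.trace

/-- The adjoint `Φ^*` of `Φ` with respect to the Hilbert-Schmidt inner product
`⟨X, Y⟩ = tr (Xᴴ Y)`, given by its matrix entries. -/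
def hsAdjoint {d : ℕ} (Φ : Mat d →ₗ[ℂ] Mat d) (A : Mat d) : Mat d :=
  Matrix.of fun a b => ((Φ (Matrix.single a b 1))ᴴ * A).trace

theorem trace_hsAdjoint {d : ℕ} (Φ : Mat d →ₗ[ℂ] Mat d) (X A : Mat d) :
    (Xᴴ * hsAdjoint Φ A).trace = ((Φ X)ᴴ * A).trace := by
  conv_rhs => rw [Matrix.matrix_eq_sum_single X]
  have h : ∀ a b, Matrix.single a b (X a b) = X a b • (Matrix.single a b (1 : ℂ) : Mat d) := by
    intro a b; simp [Matrix.smul_single]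
  simp only [h, map_sum, map_smul, Matrix.conjTranspose_sum, Matrix.conjTranspose_smul,
    Matrix.sum_mul, Matrix.smul_mul, Matrix.trace_sum, Matrix.trace_smul]
  rw [Finset.sum_comm]
  simp [Matrix.trace, Matrix.mul_apply, hsAdjoint, Matrix.conjTranspose_apply]

/-- The POVM `E'_i = I_i^*(1)` that an instrument implements. -/
def povm {d m : ℕ} (I : Fin m → (Mat d →ₗ[ℂ] Mat d)) (i : Fin m) : Mat d := hsAdjoint (I i) 1

/-- The trace norm `‖A‖₁ = tr √(Aᴴ A)`, i.e. the sum of the singular values of `A`. -/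
def traceNorm {n : Type*} [Fintype n] [DecidableEq n] (A : Matrix n n ℂ) : ℝ :=
  ∑ i, √((Matrix.isHermitian_conjTranspose_mul_self A).eigenvalues i)

/-- The diamond norm `sup_ρ ‖(Φ ⊗ id_d)(ρ)‖₁`, over all density operators `ρ` on `ℂ^d ⊗ ℂ^d`. -/
def diamondNorm {d : ℕ} (Φ : Mat d →ₗ[ℂ] Mat d) : ℝ :=
  sSup {x : ℝ | ∃ ρ : Matrix (Fin d × Fin d) (Fin d × Fin d) ℂ,
    IsDensity ρ ∧ x = traceNorm (tensorId Φ d ρ)}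

/-- The disturbance `Δ_⋄ = ‖∑ᵢ Iᵢ - id‖_⋄` caused by an instrument. -/
def disturbance {d m : ℕ} (I : Fin m → (Mat d →ₗ[ℂ] Mat d)) : ℝ :=
  diamondNorm (∑ i, I i - LinearMap.id)

/-- The measurement error `δ_TV`: the worst-case total variational distance
`sup_ρ ½ ∑ᵢ |tr (E'ᵢ ρ) - tr (Qᵢ ρ)|` between the outcome distributions of the POVM
implemented by the instrument `I` and of the target measurement `Q`. -/
def measurementError {d m : ℕ} (Q : Fin m → Mat d) (I : Fin m → (Mat d →ₗ[ℂ] Mat d)) : ℝ :=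
  sSup {x : ℝ | ∃ ρ : Mat d, IsDensity ρ ∧
    x = 1 / 2 * ∑ i, ‖(povm I i * ρ).trace - (Q i * ρ).trace‖}

/-- The tradeoff function. It depends on the number of outcomes `m` only. -/
def tradeoff (m : ℕ) (Δ : ℝ) : ℝ :=
  if Δ ≤ 2 - 2 / (m : ℝ) then
    1 / (2 * (m : ℝ)) * (√((2 - Δ) * ((m : ℝ) - 1)) - √Δ) ^ 2
  else 0

end QTradeoff

end

/-!
The proof compares an instrument with its action on one entangled state and needs neither a
symmetrisation nor semidefinite programming.

*Lower bound.* Choose a unit vector `ψₐ` in the range of each `Qₐ` and let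
`S = ∑ₐ ψₐ ⊗ e_{ι a}`, with `ι` injective, so that `‖S‖² = m`. The reflection `1 - 2 |S⟩⟨S| / m`
is a contraction, hence testing the diamond norm with the state `|S⟩⟨S| / m` gives
`2 (1 - f / m²) ≤ Δ_⋄`, where `f = ⟨S|(∑ᵢ Iᵢ ⊗ id)(|S⟩⟨S|)|S⟩` (`two_mul_one_sub_overlap_le`).
By complete positivity, the form defined by `(Iᵢ ⊗ id)(|S⟩⟨S|)` is a Hilbert seminorm squared, and
the triangle inequality yields `f ≤ ∑ᵢ (∑ₐ y_{ia})²` with `y_{ia}² = tr Iᵢ(|ψₐ⟩⟨ψₐ|)`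
(`overlap_le`). In every column of `y` the squares sum up to `1`, and the state `ψₐ` shows
`1 - y_{aa}² ≤ δ_TV` (`one_sub_trace_le_measurementError`). What remains is a Cauchy-Schwarz
estimate on real numbers (`tradeoff_le_of_sum_sq`).

*Tightness.* For `D ≤ 2 - 2 / m` the instrument with Kraus operators `a Qᵢ + b 𝟙` has total
channel `a² 𝓛 + (1 - a²) id`, where `𝓛` is the dephasing channel of `Q`; for larger `D` the
measurement `Q` is performed perfectly, and afterwards with probability `t` an isometry is applied
that moves `ψᵢ` to a vector orthogonal to it. In both cases the disturbance is known exactly. It is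
bounded below by the overlap `f`, and above since, for a channel `Φ`, positivity of `Φ - p id` on
`ℂ^d ⊗ ℂ^d` forces `‖Φ - id‖_⋄ ≤ 2 (1 - p)` (`diamondNorm_sub_id_le`); the value of `p` comes
from the pinching inequality `X ≤ m ∑ᵢ Pᵢ X Pᵢᴴ` (`posSemidef_pinching_sub`). The measurement error
only has to be bounded from above, because the lower bound supplies the other inequality.
-/

noncomputable section

namespace QTradeoff

open Matrix

/-! ### Cauchy-Schwarz inequalities and the trace norm -/

section TraceNorm

variable {n : Type*} [Fintype n]

theorem norm_star_dotProduct_le (x y : n → ℂ) :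
    ‖star x ⬝ᵥ y‖ ≤ √(star x ⬝ᵥ x).re * √(star y ⬝ᵥ y).re := by
  have key (z : n → ℂ) : √(star z ⬝ᵥ z).re = ‖WithLp.toLp 2 z‖ := by
    rw [@norm_eq_sqrt_re_inner ℂ, EuclideanSpace.inner_eq_star_dotProduct]
    simp [dotProduct_comm]
  have h := norm_inner_le_norm (𝕜 := ℂ) (WithLp.toLp 2 x) (WithLp.toLp 2 y)
  rwa [EuclideanSpace.inner_eq_star_dotProduct, dotProduct_comm, ← key, ← key] at h

/-- The triangle inequality for the seminorm `x ↦ √⟨x, C x⟩` of a positive semidefinite `C`. -/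
theorem re_star_dotProduct_mulVec_sum_le {ι : Type*} {C : Matrix n n ℂ} (hC : C.PosSemidef)
    (s : Finset ι) (u : ι → n → ℂ) :
    (star (∑ a ∈ s, u a) ⬝ᵥ C *ᵥ ∑ a ∈ s, u a).re ≤
      (∑ a ∈ s, √(star (u a) ⬝ᵥ C *ᵥ u a).re) ^ 2 := by
  classical
  obtain ⟨B, rfl⟩ : ∃ B : Matrix n n ℂ, C = Bᴴ * B := by
    open scoped MatrixOrder in
    obtain ⟨B, hB⟩ := CStarAlgebra.nonneg_iff_eq_star_mul_self.mp hC.nonneg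
    exact ⟨B, hB⟩
  have key (z : n → ℂ) : (star z ⬝ᵥ (Bᴴ * B) *ᵥ z).re = ‖WithLp.toLp 2 (B *ᵥ z)‖ ^ 2 := by
    rw [@norm_sq_eq_re_inner ℂ, EuclideanSpace.inner_eq_star_dotProduct, ← mulVec_mulVec,
      dotProduct_mulVec, ← star_mulVec, dotProduct_comm]
    simp
  simp only [key, Real.sqrt_sq (norm_nonneg _)]
  have : WithLp.toLp 2 (B *ᵥ ∑ a ∈ s, u a) = ∑ a ∈ s, WithLp.toLp 2 (B *ᵥ u a) := by
    rw [mulVec_sum, WithLp.toLp_sum]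
  rw [this]
  gcongr
  exact norm_sum_le _ _

theorem trace_mul_nonneg_of_isHermitian_idempotent {A P : Matrix n n ℂ} (hA : A.PosSemidef)
    (hP : P.IsHermitian) (hPP : P * P = P) : 0 ≤ (A * P).trace := by
  have h := (hA.mul_mul_conjTranspose_same P).trace_nonneg
  rwa [hP.eq, trace_mul_comm, ← Matrix.mul_assoc, hPP, trace_mul_comm] at h

/-- The Cauchy-Schwarz inequality for the form `(T, V) ↦ tr (Tᴴ A V)`, with arithmetic means. -/
theorem abs_two_mul_re_trace_le {A T V : Matrix n n ℂ} (hA : A.PosSemidef) :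
    |2 * (Tᴴ * A * V).trace.re| ≤ (Tᴴ * A * T).trace.re + (Vᴴ * A * V).trace.re := by
  have hsym : (Vᴴ * A * T).trace.re = (Tᴴ * A * V).trace.re := by
    have := trace_conjTranspose (Tᴴ * A * V)
    rw [conjTranspose_mul, conjTranspose_mul, conjTranspose_conjTranspose, hA.1.eq,
      ← Matrix.mul_assoc] at this
    rw [this]; simp
  have h1 := (Complex.le_def.mp (hA.conjTranspose_mul_mul_same (T - V)).trace_nonneg).1
  have h2 := (Complex.le_def.mp (hA.conjTranspose_mul_mul_same (T + V)).trace_nonneg).1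
  simp only [conjTranspose_sub, conjTranspose_add, Matrix.sub_mul, Matrix.mul_sub, Matrix.add_mul,
    Matrix.mul_add, trace_sub, trace_add, Complex.sub_re, Complex.add_re, Complex.zero_re] at h1 h2
  rw [abs_le]
  constructor <;> linarith

variable [DecidableEq n]

/-- A unitary `V` whose columns are right singular vectors of `A`, with singular values `s`: the
columns of `A * V` are orthogonal and have norms `s i`. -/
theorem exists_singular_basis (A : Matrix n n ℂ) : ∃ V : Matrix n n ℂ, ∃ s : n → ℝ,
    (∀ i, 0 ≤ s i) ∧ Vᴴ * V = 1 ∧ V * Vᴴ = 1 ∧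
    (A * V)ᴴ * (A * V) = diagonal (fun i => ((s i ^ 2 : ℝ) : ℂ)) ∧ traceNorm A = ∑ i, s i := by
  set hA := isHermitian_conjTranspose_mul_self A
  have hps : (Aᴴ * A).PosSemidef := posSemidef_conjTranspose_mul_self A
  refine ⟨hA.eigenvectorUnitary, fun i => √(hA.eigenvalues i), fun i => Real.sqrt_nonneg _,
    Unitary.coe_star_mul_self _, Unitary.coe_mul_star_self _, ?_, rfl⟩
  have h := hA.conjStarAlgAut_star_eigenvectorUnitary
  rw [Unitary.conjStarAlgAut_apply] at h
  rw [conjTranspose_mul, Matrix.mul_assoc, ← Matrix.mul_assoc Aᴴ, ← Matrix.mul_assoc]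
  simp only [Unitary.coe_star, star_eq_conjTranspose, conjTranspose_conjTranspose] at h
  rw [h]
  congr 1
  ext i
  rw [Real.sq_sqrt (hps.eigenvalues_nonneg i)]
  rfl

theorem traceNorm_nonneg (A : Matrix n n ℂ) : 0 ≤ traceNorm A :=
  Finset.sum_nonneg fun _ _ => Real.sqrt_nonneg _

/-- Duality of the trace norm and the operator norm, for an isometry `U`: compute the trace in a
basis of right singular vectors. -/
theorem norm_trace_mul_le_traceNorm {U : Matrix n n ℂ} (hU : Uᴴ * U = 1) (A : Matrix n n ℂ) :
    ‖(U * A).trace‖ ≤ traceNorm A := by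
  obtain ⟨V, s, hs, hV, hV', hAV, htr⟩ := exists_singular_basis A
  have h1 : (U * A).trace = (Vᴴ * (U * (A * V))).trace := by
    rw [trace_mul_comm Vᴴ, Matrix.mul_assoc U, Matrix.mul_assoc A, hV', Matrix.mul_one]
  rw [h1, htr]
  refine (norm_sum_le _ _).trans (Finset.sum_le_sum fun i _ => ?_)
  have h2 (X Y : Matrix n n ℂ) : (Xᴴ * Y) i i = star (fun j => X j i) ⬝ᵥ fun j => Y j i := by
    simp [Matrix.mul_apply, dotProduct]
  rw [diag_apply, h2]
  refine (norm_star_dotProduct_le _ _).trans ?_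
  rw [← h2, ← h2, hV, conjTranspose_mul, Matrix.mul_assoc, ← Matrix.mul_assoc Uᴴ, hU,
    Matrix.one_mul, hAV]
  simp only [one_apply_eq, diagonal_apply_eq, Complex.one_re, Complex.ofReal_re, Real.sqrt_one,
    one_mul]
  rw [Real.sqrt_sq (hs i)]

/-- The triangle inequality for a difference of two positive semidefinite matrices. With `T` the
matrix of left singular vectors, `‖A - B‖₁ = Re tr (Tᴴ (A - B) V)`, and both terms are bounded by
`abs_two_mul_re_trace_le`, as `T Tᴴ` is a projection. -/
theorem traceNorm_sub_le {A B : Matrix n n ℂ} (hA : A.PosSemidef) (hB : B.PosSemidef) :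
    traceNorm (A - B) ≤ A.trace.re + B.trace.re := by
  obtain ⟨V, s, hs, hV, hV', hAV, htr⟩ := exists_singular_basis (A - B)
  set Y := (A - B) * V with hY
  -- Since `0⁻¹ = 0`, the columns of `T` belonging to zero singular values vanish.
  let g : n → ℂ := fun i => ((s i)⁻¹ : ℝ)
  let T := Y * diagonal g
  have hg : (diagonal g)ᴴ = diagonal g := by
    rw [diagonal_conjTranspose]; congr 1; ext i; simp [g]
  have hT : Tᴴ = diagonal g * Yᴴ := by rw [conjTranspose_mul, hg]
  have hTY : (Tᴴ * Y).trace.re = ∑ i, s i := by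
    rw [hT, Matrix.mul_assoc, hAV, diagonal_mul_diagonal, trace_diagonal, Complex.re_sum]
    refine Finset.sum_congr rfl fun i _ => ?_
    simp only [g]
    rw [← Complex.ofReal_mul, Complex.ofReal_re]
    by_cases h : s i = 0
    · simp [h]
    · field_simp
  have hTTT : T * Tᴴ * T = T := by
    rw [hT]
    simp only [T]
    rw [← Matrix.mul_assoc (Y * diagonal g), Matrix.mul_assoc, ← Matrix.mul_assoc Yᴴ, hAV,
      Matrix.mul_assoc Y, Matrix.mul_assoc Y, diagonal_mul_diagonal, diagonal_mul_diagonal,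
      diagonal_mul_diagonal]
    congr 2
    ext i
    simp only [g]
    norm_cast
    by_cases h : s i = 0
    · simp [h]
    · field_simp
  have hPP : (T * Tᴴ) * (T * Tᴴ) = T * Tᴴ := by
    rw [← Matrix.mul_assoc, hTTT]
  have hP : (T * Tᴴ).IsHermitian := isHermitian_mul_conjTranspose_self T
  have hbound {C : Matrix n n ℂ} (hC : C.PosSemidef) :
      |(Tᴴ * C * V).trace.re| ≤ C.trace.re := by
    have h0 := trace_mul_nonneg_of_isHermitian_idempotent (P := 1 - T * Tᴴ) hC
      (isHermitian_one.sub hP) (by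
        simp [Matrix.sub_mul, Matrix.mul_sub, hPP])
    have h1 := (Complex.le_def.mp h0).1
    rw [Matrix.mul_sub, Matrix.mul_one, trace_sub, Complex.sub_re, Complex.zero_re] at h1
    have h2 := abs_two_mul_re_trace_le (T := T) (V := V) hC
    have h3 : (Tᴴ * C * T).trace = (C * (T * Tᴴ)).trace := by
      rw [trace_mul_comm, ← Matrix.mul_assoc, trace_mul_comm]
    have h4 : (Vᴴ * C * V).trace = C.trace := by
      rw [trace_mul_comm, ← Matrix.mul_assoc, hV', Matrix.one_mul]
    rw [h3, h4, abs_mul, abs_two] at h2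
    linarith
  rw [htr, ← hTY, hY, ← Matrix.mul_assoc, Matrix.mul_sub, Matrix.sub_mul, trace_sub,
    Complex.sub_re]
  have := abs_le.mp (hbound hA)
  have := abs_le.mp (hbound hB)
  linarith

/-- The pinching inequality `X ≤ m ∑ᵢ Pᵢ X Pᵢᴴ`, divided by `m`. It needs only `∑ᵢ Pᵢ = 1`. -/
theorem posSemidef_pinching_sub {m : ℕ} (hm : 1 ≤ m) {X : Matrix n n ℂ} (hX : X.PosSemidef)
    (P : Fin m → Matrix n n ℂ) (hP : ∑ i, P i = 1) :
    (∑ i, P i * X * (P i)ᴴ - ((1 / m : ℝ) : ℂ) • X).PosSemidef := by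
  have hps := posSemidef_sum Finset.univ fun i _ => hX.mul_mul_conjTranspose_same (P i)
  have hherm : (∑ i, P i * X * (P i)ᴴ - ((1 / m : ℝ) : ℂ) • X).IsHermitian :=
    hps.1.sub (by
      rw [IsHermitian, conjTranspose_smul, hX.1.eq, Complex.star_def, Complex.conj_ofReal])
  refine .of_dotProduct_mulVec_nonneg hherm fun x => ?_
  have hm0 : (0 : ℝ) < m := by exact_mod_cast hm
  let u : Fin m → n → ℂ := fun i => (P i)ᴴ *ᵥ x
  have hu : ∑ i, u i = x := by
    simp only [u]
    rw [← Matrix.sum_mulVec, ← conjTranspose_sum, hP, conjTranspose_one, one_mulVec]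
  have h1 := re_star_dotProduct_mulVec_sum_le hX Finset.univ u
  rw [hu] at h1
  have h2 := sq_sum_le_card_mul_sum_sq (s := Finset.univ)
    (f := fun i => √(star (u i) ⬝ᵥ X *ᵥ u i).re)
  have h3 (i) : √(star (u i) ⬝ᵥ X *ᵥ u i).re ^ 2 = (star x ⬝ᵥ (P i * X * (P i)ᴴ) *ᵥ x).re := by
    rw [Real.sq_sqrt (Complex.le_def.mp (hX.dotProduct_mulVec_nonneg _)).1]
    simp only [u]
    rw [star_mulVec, conjTranspose_conjTranspose, ← mulVec_mulVec, ← mulVec_mulVec,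
      dotProduct_mulVec, dotProduct_mulVec (star x)]
    simp only [dotProduct_mulVec, vecMul_vecMul]
  simp only [h3, Finset.card_univ, Fintype.card_fin] at h2
  rw [Complex.le_def]
  refine ⟨?_, ?_⟩
  · rw [Matrix.sub_mulVec, Matrix.sum_mulVec, dotProduct_sub, dotProduct_sum, smul_mulVec,
      dotProduct_smul, Complex.sub_re, Complex.re_sum, smul_eq_mul, Complex.re_ofReal_mul,
      Complex.zero_re, sub_nonneg, one_div, inv_mul_le_iff₀ hm0]
    exact h1.trans h2
  · exact (hherm.im_star_dotProduct_mulVec_self x).symm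

end TraceNorm

/-! ### Ampliations, Kraus operators and the diamond distance to the identity -/

section TensorId

variable {d k : ℕ}

theorem tensorId_apply (Φ : Mat d →ₗ[ℂ] Mat d) (X : Matrix (Fin d × Fin k) (Fin d × Fin k) ℂ)
    (p q : Fin d × Fin k) :
    tensorId Φ k X p q = Φ (Matrix.of fun i j => X (i, p.2) (j, q.2)) p.1 q.1 := rfl

theorem tensorId_add_apply (Φ Ψ : Mat d →ₗ[ℂ] Mat d)
    (X : Matrix (Fin d × Fin k) (Fin d × Fin k) ℂ) :
    tensorId (Φ + Ψ) k X = tensorId Φ k X + tensorId Ψ k X := rfl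

theorem tensorId_smul_apply (c : ℂ) (Φ : Mat d →ₗ[ℂ] Mat d)
    (X : Matrix (Fin d × Fin k) (Fin d × Fin k) ℂ) :
    tensorId (c • Φ) k X = c • tensorId Φ k X := rfl

theorem tensorId_sub_id_apply (Φ : Mat d →ₗ[ℂ] Mat d)
    (X : Matrix (Fin d × Fin k) (Fin d × Fin k) ℂ) :
    tensorId (Φ - LinearMap.id) k X = tensorId Φ k X - X := rfl

theorem tensorId_sum_apply {ι : Type*} (s : Finset ι) (Φ : ι → (Mat d →ₗ[ℂ] Mat d))
    (X : Matrix (Fin d × Fin k) (Fin d × Fin k) ℂ) :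
    tensorId (∑ i ∈ s, Φ i) k X = ∑ i ∈ s, tensorId (Φ i) k X := by
  ext p q
  simp [tensorId_apply, Matrix.sum_apply]

theorem trace_tensorId {Φ : Mat d →ₗ[ℂ] Mat d} (hΦ : ∀ ρ : Mat d, (Φ ρ).trace = ρ.trace)
    (X : Matrix (Fin d × Fin k) (Fin d × Fin k) ℂ) : (tensorId Φ k X).trace = X.trace := by
  have h (Y : Matrix (Fin d × Fin k) (Fin d × Fin k) ℂ) :
      Y.trace = ∑ c, (Matrix.of fun i j => Y (i, c) (j, c)).trace := by
    simp only [trace, diag_apply, of_apply, Fintype.sum_prod_type]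
    exact Finset.sum_comm
  rw [h (tensorId Φ k X), h X]
  refine Finset.sum_congr rfl fun c _ => ?_
  rw [← hΦ (Matrix.of fun i j => X (i, c) (j, c))]
  rfl

/-- The completely positive map `X ↦ K X Kᴴ` with the single Kraus operator `K`. -/
def conjMap (K : Mat d) : Mat d →ₗ[ℂ] Mat d where
  toFun X := K * X * Kᴴ
  map_add' X Y := by rw [Matrix.mul_add, Matrix.add_mul]
  map_smul' c X := by simp

theorem conjMap_apply (K X : Mat d) : conjMap K X = K * X * Kᴴ := rfl

theorem tensorId_conjMap (K : Mat d) (X : Matrix (Fin d × Fin k) (Fin d × Fin k) ℂ) :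
    tensorId (conjMap K) k X = (K ⊗ₖ (1 : Mat k)) * X * (K ⊗ₖ (1 : Mat k))ᴴ := by
  ext p q
  simp [tensorId_apply, conjMap_apply, Matrix.mul_apply, Fintype.sum_prod_type, one_apply,
    kroneckerMap_apply, apply_ite]

theorem isCompletelyPositive_conjMap (K : Mat d) : IsCompletelyPositive (conjMap K) := by
  intro k X hX
  rw [tensorId_conjMap]
  exact hX.mul_mul_conjTranspose_same _

theorem IsCompletelyPositive.add {Φ Ψ : Mat d →ₗ[ℂ] Mat d} (hΦ : IsCompletelyPositive Φ)
    (hΨ : IsCompletelyPositive Ψ) : IsCompletelyPositive (Φ + Ψ) := fun k X hX =>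
  (hΦ k X hX).add (hΨ k X hX)

theorem IsCompletelyPositive.smul {Φ : Mat d →ₗ[ℂ] Mat d} (hΦ : IsCompletelyPositive Φ) {c : ℝ}
    (hc : 0 ≤ c) : IsCompletelyPositive ((c : ℂ) • Φ) := fun k X hX =>
  (hΦ k X hX).smul (Complex.zero_le_real.mpr hc)

theorem IsCompletelyPositive.posSemidef {Φ : Mat d →ₗ[ℂ] Mat d} (hΦ : IsCompletelyPositive Φ)
    {X : Mat d} (hX : X.PosSemidef) : (Φ X).PosSemidef :=
  -- Complete positivity with an ancilla of dimension one.
  (hΦ 1 (X.submatrix Prod.fst Prod.fst) (hX.submatrix _)).submatrix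
    fun i : Fin d => (i, (0 : Fin 1))

/-- Outcome probabilities of the implemented POVM, `tr (Φ^*(1) X) = tr (Φ X)`. -/
theorem trace_hsAdjoint_one_mul {Φ : Mat d →ₗ[ℂ] Mat d} (hΦ : IsCompletelyPositive Φ)
    {X : Mat d} (hX : X.PosSemidef) : (hsAdjoint Φ 1 * X).trace = (Φ X).trace := by
  have h := trace_hsAdjoint Φ X 1
  rwa [hX.1.eq, (hΦ.posSemidef hX).1.eq, Matrix.mul_one, trace_mul_comm] at h

theorem traceNorm_tensorId_sub_id_le {Φ : Mat d →ₗ[ℂ] Mat d}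
    (hΦ : ∀ ρ : Mat d, (Φ ρ).trace = ρ.trace) {p : ℝ} (hp : p ≤ 1)
    (h : ∀ X : Matrix (Fin d × Fin k) (Fin d × Fin k) ℂ, X.PosSemidef →
      (tensorId Φ k X - (p : ℂ) • X).PosSemidef)
    {ρ : Matrix (Fin d × Fin k) (Fin d × Fin k) ℂ} (hρ : IsDensity ρ) :
    traceNorm (tensorId (Φ - LinearMap.id) k ρ) ≤ 2 * (1 - p) := by
  have h1 : tensorId (Φ - LinearMap.id) k ρ =
      (tensorId Φ k ρ - (p : ℂ) • ρ) - ((1 - p : ℝ) : ℂ) • ρ := by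
    rw [tensorId_sub_id_apply]
    push_cast
    module
  rw [h1]
  refine (traceNorm_sub_le (h ρ hρ.posSemidef) (hρ.posSemidef.smul
    (Complex.zero_le_real.mpr (sub_nonneg.mpr hp)))).trans ?_
  rw [trace_sub, trace_tensorId hΦ, trace_smul, trace_smul, hρ.trace_eq_one]
  simp
  linarith

/-- For the difference of a channel and the identity, the set in the definition of the diamond norm
is bounded, so that every density operator gives a lower bound. -/
theorem traceNorm_le_diamondNorm {Φ : Mat d →ₗ[ℂ] Mat d} (hcp : IsCompletelyPositive Φ)
    (htp : ∀ ρ : Mat d, (Φ ρ).trace = ρ.trace)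
    {ρ : Matrix (Fin d × Fin d) (Fin d × Fin d) ℂ} (hρ : IsDensity ρ) :
    traceNorm (tensorId (Φ - LinearMap.id) d ρ) ≤ diamondNorm (Φ - LinearMap.id) := by
  refine le_csSup ⟨2 * (1 - 0), ?_⟩ ⟨ρ, hρ, rfl⟩
  rintro _ ⟨σ, hσ, rfl⟩
  exact traceNorm_tensorId_sub_id_le htp zero_le_one (fun X hX => by simpa using hcp d X hX) hσ

theorem diamondNorm_nonneg (Φ : Mat d →ₗ[ℂ] Mat d) : 0 ≤ diamondNorm Φ := by
  refine Real.sSup_nonneg ?_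
  rintro _ ⟨ρ, -, rfl⟩
  exact traceNorm_nonneg _

/-- If `Φ - p id` stays positive on `ℂ^d ⊗ ℂ^d`, then
`Φ - id = (Φ - p id) - (1 - p) id` is a difference of two positive maps that both scale the trace
by `1 - p`. -/
theorem diamondNorm_sub_id_le {Φ : Mat d →ₗ[ℂ] Mat d}
    (hΦ : ∀ ρ : Mat d, (Φ ρ).trace = ρ.trace) {p : ℝ} (hp : p ≤ 1)
    (h : ∀ X : Matrix (Fin d × Fin d) (Fin d × Fin d) ℂ, X.PosSemidef →
      (tensorId Φ d X - (p : ℂ) • X).PosSemidef) :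
    diamondNorm (Φ - LinearMap.id) ≤ 2 * (1 - p) := by
  refine Real.sSup_le ?_ (by linarith)
  rintro _ ⟨ρ, hρ, rfl⟩
  exact traceNorm_tensorId_sub_id_le hΦ hp h hρ

end TensorId

/-! ### The overlap of an entangled vector with its image -/

section Overlap

variable {d k m : ℕ}

/-- The product vector `x ⊗ e_c`. -/
def tensorSingle (x : Fin d → ℂ) (c : Fin k) : Fin d × Fin k → ℂ :=
  fun p => if p.2 = c then x p.1 else 0

/-- The unnormalised entangled vector `∑ₐ ψₐ ⊗ e_{ι a}`. -/
def entangledVec (ψ : Fin m → Fin d → ℂ) (ι : Fin m → Fin k) : Fin d × Fin k → ℂ :=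
  ∑ a, tensorSingle (ψ a) (ι a)

theorem entangledVec_apply (ψ : Fin m → Fin d → ℂ) {ι : Fin m → Fin k}
    (hι : Function.Injective ι) (i : Fin d) (a : Fin m) : entangledVec ψ ι (i, ι a) = ψ a i := by
  simp [entangledVec, tensorSingle, hι.eq_iff]

theorem star_tensorSingle_dotProduct_mulVec (X : Matrix (Fin d × Fin k) (Fin d × Fin k) ℂ)
    (x y : Fin d → ℂ) (a b : Fin k) :
    star (tensorSingle x a) ⬝ᵥ X *ᵥ tensorSingle y b =
      star x ⬝ᵥ (Matrix.of fun i j => X (i, a) (j, b)) *ᵥ y := by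
  simp [tensorSingle, dotProduct, mulVec, Fintype.sum_prod_type, apply_ite, Finset.mul_sum]

theorem star_tensorSingle_dotProduct (x y : Fin d → ℂ) (a b : Fin k) :
    star (tensorSingle x a) ⬝ᵥ tensorSingle y b = if a = b then star x ⬝ᵥ y else 0 := by
  simp only [tensorSingle, dotProduct, Fintype.sum_prod_type, Pi.star_apply, apply_ite star,
    star_zero, mul_ite, ite_mul, zero_mul, mul_zero]
  by_cases h : a = b
  · simp [h]
  · simp [h, Ne.symm h]

/-- The blocks of `(Φ ⊗ id)(|S⟩⟨S|)` are `Φ(|ψₐ⟩⟨ψ_b|)`: the vector `S` encodes the Choi matrix of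
`Φ` on the span of the `ψₐ`. -/
theorem tensorId_entangledVec_block (Φ : Mat d →ₗ[ℂ] Mat d) (ψ : Fin m → Fin d → ℂ)
    {ι : Fin m → Fin k} (hι : Function.Injective ι) (a b : Fin m) :
    (Matrix.of fun i j => tensorId Φ k
      (vecMulVec (entangledVec ψ ι) (star (entangledVec ψ ι))) (i, ι a) (j, ι b)) =
      Φ (vecMulVec (ψ a) (star (ψ b))) := by
  ext i j
  rw [of_apply, tensorId_apply]
  have : (Matrix.of fun i j => vecMulVec (entangledVec ψ ι) (star (entangledVec ψ ι))
      (i, ι a) (j, ι b)) = vecMulVec (ψ a) (star (ψ b)) := by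
    ext i j
    simp [vecMulVec_apply, entangledVec_apply ψ hι]
  rw [this]

theorem star_entangledVec_dotProduct {ψ : Fin m → Fin d → ℂ} (hψ : ∀ a, star (ψ a) ⬝ᵥ ψ a = 1)
    {ι : Fin m → Fin k} (hι : Function.Injective ι) :
    star (entangledVec ψ ι) ⬝ᵥ entangledVec ψ ι = m := by
  simp [entangledVec, star_sum, sum_dotProduct, dotProduct_sum, star_tensorSingle_dotProduct,
    hι.eq_iff, hψ]

/-- The overlap `⟨S|(Φ ⊗ id)(|S⟩⟨S|)|S⟩` of the entangled vector `S` with its image under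
`Φ ⊗ id`. -/
def overlap (ψ : Fin m → Fin d → ℂ) (ι : Fin m → Fin k) (Φ : Mat d →ₗ[ℂ] Mat d) : ℝ :=
  (star (entangledVec ψ ι) ⬝ᵥ tensorId Φ k
    (vecMulVec (entangledVec ψ ι) (star (entangledVec ψ ι))) *ᵥ entangledVec ψ ι).re

theorem overlap_add (ψ : Fin m → Fin d → ℂ) (ι : Fin m → Fin k) (Φ Ψ : Mat d →ₗ[ℂ] Mat d) :
    overlap ψ ι (Φ + Ψ) = overlap ψ ι Φ + overlap ψ ι Ψ := by
  simp [overlap, tensorId_add_apply, Matrix.add_mulVec, dotProduct_add]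

theorem overlap_smul (ψ : Fin m → Fin d → ℂ) (ι : Fin m → Fin k) (c : ℝ)
    (Φ : Mat d →ₗ[ℂ] Mat d) :
    overlap ψ ι ((c : ℂ) • Φ) = c * overlap ψ ι Φ := by
  simp [overlap, tensorId_smul_apply, smul_mulVec, dotProduct_smul]

theorem overlap_sum {κ : Type*} (s : Finset κ) (ψ : Fin m → Fin d → ℂ) (ι : Fin m → Fin k)
    (Φ : κ → (Mat d →ₗ[ℂ] Mat d)) :
    overlap ψ ι (∑ i ∈ s, Φ i) = ∑ i ∈ s, overlap ψ ι (Φ i) := by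
  simp [overlap, tensorId_sum_apply, Matrix.sum_mulVec, dotProduct_sum]

theorem overlap_conjMap (ψ : Fin m → Fin d → ℂ) {ι : Fin m → Fin k}
    (hι : Function.Injective ι) (K : Mat d) :
    overlap ψ ι (conjMap K) = ‖∑ a, star (ψ a) ⬝ᵥ K *ᵥ ψ a‖ ^ 2 := by
  have h : ∑ a, star (ψ a) ⬝ᵥ K *ᵥ ψ a =
      star (entangledVec ψ ι) ⬝ᵥ (K ⊗ₖ (1 : Mat k)) *ᵥ entangledVec ψ ι := by
    simp only [entangledVec, star_sum, sum_dotProduct, mulVec_sum, dotProduct_sum,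
      star_tensorSingle_dotProduct_mulVec]
    refine Finset.sum_congr rfl fun a _ => ?_
    rw [Finset.sum_eq_single a]
    · congr 2
      ext i j
      simp
    · intro b _ hb
      have : (Matrix.of fun i j => (K ⊗ₖ (1 : Mat k)) (i, ι b) (j, ι a)) = 0 := by
        ext i j
        simp [one_apply_ne (hι.ne hb)]
      rw [this]; simp
    · simp
  rw [h, overlap, tensorId_conjMap, mul_vecMulVec, vecMulVec_mul, vecMulVec_mulVec,
    ← star_mulVec, dotProduct_smul, star_dotProduct, MulOpposite.smul_eq_mul_unop,
    MulOpposite.unop_op, Complex.star_def, Complex.mul_conj', ← Complex.ofReal_pow,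
    Complex.ofReal_re]

/-- The seminorm given by `(Φ ⊗ id)(|S⟩⟨S|)` takes on `ψₐ ⊗ e_{ι a}` the value
`√⟨ψₐ, Φ(|ψₐ⟩⟨ψₐ|) ψₐ⟩`, which is at most `√(tr Φ(|ψₐ⟩⟨ψₐ|))`. -/
theorem overlap_le {Φ : Mat d →ₗ[ℂ] Mat d} (hΦ : IsCompletelyPositive Φ)
    {ψ : Fin m → Fin d → ℂ} (hψ : ∀ a, star (ψ a) ⬝ᵥ ψ a = 1)
    {ι : Fin m → Fin k} (hι : Function.Injective ι) :
    overlap ψ ι Φ ≤ (∑ a, √(Φ (vecMulVec (ψ a) (star (ψ a)))).trace.re) ^ 2 := by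
  refine (re_star_dotProduct_mulVec_sum_le (hΦ k _ (posSemidef_vecMulVec_self_star _))
    Finset.univ _).trans ?_
  gcongr with a
  rw [star_tensorSingle_dotProduct_mulVec, tensorId_entangledVec_block Φ ψ hι]
  have hps := hΦ.posSemidef (posSemidef_vecMulVec_self_star (ψ a))
  have h := trace_mul_nonneg_of_isHermitian_idempotent
    (P := 1 - vecMulVec (ψ a) (star (ψ a))) hps
    (isHermitian_one.sub (posSemidef_vecMulVec_self_star (ψ a)).1)
    (by simp [Matrix.sub_mul, Matrix.mul_sub, vecMulVec_mul_vecMulVec, hψ])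
  rw [Matrix.mul_sub, Matrix.mul_one, trace_sub, mul_vecMulVec, trace_vecMulVec,
    dotProduct_comm] at h
  exact sub_nonneg.mp h

/-- The lower bound on the diamond norm given by the state `R = |S⟩⟨S| / m` and the reflection
`1 - 2 R`. -/
theorem two_mul_one_sub_overlap_le (hm : 1 ≤ m) {Φ : Mat d →ₗ[ℂ] Mat d}
    (hcp : IsCompletelyPositive Φ) (htp : ∀ ρ : Mat d, (Φ ρ).trace = ρ.trace)
    {ψ : Fin m → Fin d → ℂ} (hψ : ∀ a, star (ψ a) ⬝ᵥ ψ a = 1)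
    {ι : Fin m → Fin d} (hι : Function.Injective ι) :
    2 * (1 - overlap ψ ι Φ / m ^ 2) ≤ diamondNorm (Φ - LinearMap.id) := by
  have hm0 : (0 : ℝ) < m := by exact_mod_cast hm
  have hm0' : (m : ℂ) ≠ 0 := by exact_mod_cast hm0.ne'
  set S := entangledVec ψ ι with hS
  have hSS : star S ⬝ᵥ S = m := star_entangledVec_dotProduct hψ hι
  set R := ((m : ℂ)⁻¹) • vecMulVec S (star S) with hR
  have hRps : R.PosSemidef := (posSemidef_vecMulVec_self_star S).smul
    (by
      rw [← Complex.ofReal_natCast, ← Complex.ofReal_inv]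
      exact Complex.zero_le_real.mpr (by positivity))
  have hRtr : R.trace = 1 := by
    rw [hR, trace_smul, trace_vecMulVec, dotProduct_comm, hSS, smul_eq_mul, inv_mul_cancel₀ hm0']
  have hRR : R * R = R := by
    rw [hR, Matrix.smul_mul, Matrix.mul_smul, vecMulVec_mul_vecMulVec, hSS, vecMulVec_smul,
      smul_smul, smul_smul, mul_assoc, inv_mul_cancel₀ hm0', mul_one]
  refine le_trans ?_ (traceNorm_le_diamondNorm hcp htp ⟨hRps, hRtr⟩)
  have hU : (1 - (2 : ℂ) • R)ᴴ * (1 - (2 : ℂ) • R) = 1 := by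
    rw [conjTranspose_sub, conjTranspose_smul, hRps.1.eq, conjTranspose_one]
    simp [Matrix.sub_mul, Matrix.mul_sub, hRR]
    module
  refine le_trans ?_ (norm_trace_mul_le_traceNorm hU _)
  refine le_trans (le_of_eq ?_) (Complex.re_le_norm _)
  have h1 (X : Matrix (Fin d × Fin d) (Fin d × Fin d) ℂ) :
      (R * X).trace = (m : ℂ)⁻¹ * (star S ⬝ᵥ X *ᵥ S) := by
    rw [hR, Matrix.smul_mul, trace_smul, trace_mul_comm, mul_vecMulVec, trace_vecMulVec,
      dotProduct_comm, smul_eq_mul]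
  rw [tensorId_sub_id_apply, Matrix.sub_mul, Matrix.one_mul, Matrix.smul_mul, Matrix.mul_sub, hRR,
    trace_sub, trace_smul, trace_sub, trace_sub, trace_tensorId htp, h1, hRtr, hR, map_smul,
    smul_mulVec, dotProduct_smul]
  rw [overlap, ← hS]
  generalize star S ⬝ᵥ _ = z
  simp only [smul_eq_mul]
  rw [div_eq_mul_inv]
  have : (m : ℂ)⁻¹ * ((m : ℂ)⁻¹ * z) = (((m : ℝ) ^ 2)⁻¹ : ℝ) * z := by
    push_cast; field_simp
  rw [this]
  generalize ((m : ℝ) ^ 2)⁻¹ = r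
  have e : (1 : ℂ) - 1 - 2 * ((r : ℂ) * z - 1) = 2 - ((2 * r : ℝ) : ℂ) * z := by
    push_cast; ring
  rw [e, Complex.sub_re, Complex.re_ofReal_mul, Complex.re_ofNat]
  ring

end Overlap

/-! ### Vectors adapted to a measurement -/

section Vectors

variable {d m : ℕ}

theorem exists_smul_unit {x : Fin d → ℂ} (hx : x ≠ 0) :
    ∃ c : ℂ, star (c • x) ⬝ᵥ (c • x) = 1 := by
  have hpos : 0 < star x ⬝ᵥ x := dotProduct_star_self_pos_iff.mpr hx
  obtain ⟨hre, him⟩ := Complex.lt_def.mp hpos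
  have hr : star x ⬝ᵥ x = ((star x ⬝ᵥ x).re : ℂ) := Complex.ext rfl (by simpa using him.symm)
  rw [Complex.zero_re] at hre
  refine ⟨((√(star x ⬝ᵥ x).re)⁻¹ : ℝ), ?_⟩
  rw [star_smul, smul_dotProduct, dotProduct_smul, hr, Complex.ofReal_re, Complex.star_def,
    Complex.conj_ofReal, smul_eq_mul, smul_eq_mul, ← mul_assoc]
  norm_cast
  rw [← mul_inv, Real.mul_self_sqrt hre.le, inv_mul_cancel₀ hre.ne']

/-- Unit vectors `ψₐ` in the ranges of the `Qₐ`. -/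
theorem IsVonNeumannMeasurement.exists_unit_vectors {Q : Fin m → Mat d}
    (hQ : IsVonNeumannMeasurement Q) :
    ∃ ψ : Fin m → Fin d → ℂ, (∀ a, star (ψ a) ⬝ᵥ ψ a = 1) ∧
      ∀ i a, Q i *ᵥ ψ a = if i = a then ψ a else 0 := by
  have h (a : Fin m) : ∃ x : Fin d → ℂ, star x ⬝ᵥ x = 1 ∧ Q a *ᵥ x = x := by
    obtain ⟨x, hx⟩ : ∃ x, Q a *ᵥ x ≠ 0 := by
      by_contra! h
      exact hQ.ne_zero a (Matrix.ext_of_mulVec_single fun i => by rw [h, zero_mulVec])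
    obtain ⟨c, hc⟩ := exists_smul_unit hx
    refine ⟨_, hc, ?_⟩
    rw [mulVec_smul, mulVec_mulVec, (hQ.isStarProjection a).isIdempotentElem.eq]
  choose ψ h1 h2 using h
  refine ⟨ψ, h1, fun i a => ?_⟩
  split_ifs with hia
  · rw [hia, h2]
  · rw [← h2 a, mulVec_mulVec, hQ.orthogonal i a hia, zero_mulVec]

/-- The number of outcomes is at most the dimension, so that an ancilla of dimension `d` has room
for an orthonormal family indexed by the outcomes. -/
theorem le_of_mulVec_eq_ite {Q : Fin m → Mat d} {ψ : Fin m → Fin d → ℂ}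
    (hψ : ∀ a, star (ψ a) ⬝ᵥ ψ a = 1) (hQψ : ∀ i a, Q i *ᵥ ψ a = if i = a then ψ a else 0) :
    m ≤ d := by
  have hli : LinearIndependent ℂ ψ := by
    rw [Fintype.linearIndependent_iff]
    intro g hg i
    have h := congrArg (fun x => star (ψ i) ⬝ᵥ Q i *ᵥ x) hg
    simpa [mulVec_sum, mulVec_smul, hQψ, dotProduct_sum, apply_ite, hψ] using h
  simpa using hli.fintype_card_le_finrank

/-- In dimension at least two, some unitary moves a given unit vector to an orthogonal one. -/
theorem exists_isometry_dotProduct_eq_zero (hd : 2 ≤ d) {x : Fin d → ℂ}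
    (hx : star x ⬝ᵥ x = 1) : ∃ W : Mat d, Wᴴ * W = 1 ∧ star x ⬝ᵥ W *ᵥ x = 0 := by
  have hker : LinearMap.ker (dotProductBilin ℂ ℂ (star x)) ≠ ⊥ :=
    LinearMap.ker_ne_bot_of_finrank_lt (by simp; lia)
  obtain ⟨y, hy, hy0⟩ := Submodule.exists_mem_ne_zero_of_ne_bot hker
  obtain ⟨c, hc⟩ := exists_smul_unit hy0
  have hxy : star x ⬝ᵥ (c • y) = 0 := by
    have : star x ⬝ᵥ y = 0 := by simpa using hy
    rw [dotProduct_smul, this, smul_zero]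
  generalize c • y = z at hc hxy
  have hzx : star z ⬝ᵥ x = 0 := by
    rw [star_dotProduct, hxy, star_zero]
  -- The reflection in the direction `x - z` exchanges the orthogonal unit vectors `x` and `z`.
  set v := x - z with hv
  have hvv : star v ⬝ᵥ v = 2 := by
    simp [hv, sub_dotProduct, dotProduct_sub, hx, hc, hxy, hzx]
    norm_num
  have hvx : star v ⬝ᵥ x = 1 := by simp [hv, sub_dotProduct, hx, hzx]
  have hxv : star x ⬝ᵥ v = 1 := by simp [hv, dotProduct_sub, hx, hxy]
  refine ⟨1 - vecMulVec v (star v), ?_, ?_⟩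
  · rw [conjTranspose_sub, conjTranspose_one, conjTranspose_vecMulVec, star_star]
    simp only [Matrix.sub_mul, Matrix.mul_sub, vecMulVec_mul_vecMulVec, hvv, vecMulVec_smul,
      Matrix.one_mul, Matrix.mul_one]
    module
  · rw [sub_mulVec, one_mulVec, vecMulVec_mulVec, hvx, dotProduct_sub, hx]
    simp [hxv]

end Vectors

/-! ### Outcome probabilities and the measurement error -/

section MeasurementError

variable {d m : ℕ} {Q : Fin m → Mat d}

theorem IsVonNeumannMeasurement.posSemidef (hQ : IsVonNeumannMeasurement Q) (i : Fin m) :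
    (Q i).PosSemidef := by
  have h := posSemidef_conjTranspose_mul_self (Q i)
  rwa [← star_eq_conjTranspose, (hQ.isStarProjection i).isSelfAdjoint.star_eq,
    (hQ.isStarProjection i).isIdempotentElem.eq] at h

theorem IsVonNeumannMeasurement.trace_mul_nonneg (hQ : IsVonNeumannMeasurement Q) (i : Fin m)
    {ρ : Mat d} (hρ : ρ.PosSemidef) : 0 ≤ (Q i * ρ).trace := by
  rw [trace_mul_comm]
  exact trace_mul_nonneg_of_isHermitian_idempotent hρ (hQ.posSemidef i).1
    (hQ.isStarProjection i).isIdempotentElem.eq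

theorem IsVonNeumannMeasurement.sum_trace_mul (hQ : IsVonNeumannMeasurement Q) (ρ : Mat d) :
    ∑ i, (Q i * ρ).trace = ρ.trace := by
  rw [← trace_sum, ← Matrix.sum_mul, hQ.sum_eq_one, Matrix.one_mul]

theorem IsInstrument.sum_trace {I : Fin m → (Mat d →ₗ[ℂ] Mat d)} (hI : IsInstrument I)
    (ρ : Mat d) : ∑ i, (I i ρ).trace = ρ.trace := by
  rw [← hI.tracePreserving, LinearMap.sum_apply, trace_sum]

theorem IsInstrument.isCompletelyPositive_sum {I : Fin m → (Mat d →ₗ[ℂ] Mat d)}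
    (hI : IsInstrument I) : IsCompletelyPositive (∑ i, I i) := fun k X hX => by
  rw [tensorId_sum_apply]
  exact posSemidef_sum _ fun i _ => hI.completelyPositive i k X hX

theorem sum_norm_trace_sub_le_measurementError (hQ : IsVonNeumannMeasurement Q)
    {I : Fin m → (Mat d →ₗ[ℂ] Mat d)} (hI : IsInstrument I) {ρ : Mat d} (hρ : IsDensity ρ) :
    1 / 2 * ∑ i, ‖(I i ρ).trace - (Q i * ρ).trace‖ ≤ measurementError Q I := by
  refine le_csSup ⟨1, ?_⟩ ⟨ρ, hρ, ?_⟩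
  · rintro _ ⟨σ, hσ, rfl⟩
    have h (z : ℂ) (hz : 0 ≤ z) : ‖z‖ = z.re :=
      (Complex.re_eq_norm.mpr hz).symm
    have h1 : ∑ i, ‖(povm I i * σ).trace - (Q i * σ).trace‖ ≤
        ∑ i, ((I i σ).trace.re + (Q i * σ).trace.re) := by
      refine Finset.sum_le_sum fun i _ => (norm_sub_le _ _).trans (le_of_eq ?_)
      rw [povm, trace_hsAdjoint_one_mul (hI.completelyPositive i) hσ.posSemidef,
        h _ ((hI.completelyPositive i).posSemidef hσ.posSemidef).trace_nonneg,
        h _ (hQ.trace_mul_nonneg i hσ.posSemidef)]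
    rw [Finset.sum_add_distrib, ← Complex.re_sum, ← Complex.re_sum, hQ.sum_trace_mul,
      hI.sum_trace, hσ.trace_eq_one, Complex.one_re] at h1
    linarith
  · simp only [povm, trace_hsAdjoint_one_mul (hI.completelyPositive _) hρ.posSemidef]

theorem measurementError_le {I : Fin m → (Mat d →ₗ[ℂ] Mat d)} (hI : IsInstrument I) {δ : ℝ}
    (hδ : 0 ≤ δ) (h : ∀ ρ : Mat d, IsDensity ρ →
      1 / 2 * ∑ i, ‖(I i ρ).trace - (Q i * ρ).trace‖ ≤ δ) : measurementError Q I ≤ δ := by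
  refine Real.sSup_le ?_ hδ
  rintro _ ⟨ρ, hρ, rfl⟩
  simpa only [povm, trace_hsAdjoint_one_mul (hI.completelyPositive _) hρ.posSemidef] using h ρ hρ

/-- On the state `ψⱼ` the target measurement has the certain outcome `j`, and the total variation
distance to a point mass is one minus the probability of that point. -/
theorem one_sub_trace_le_measurementError (hQ : IsVonNeumannMeasurement Q)
    {I : Fin m → (Mat d →ₗ[ℂ] Mat d)} (hI : IsInstrument I) {ψ : Fin m → Fin d → ℂ}
    (hψ : ∀ a, star (ψ a) ⬝ᵥ ψ a = 1) (hQψ : ∀ i a, Q i *ᵥ ψ a = if i = a then ψ a else 0)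
    (j : Fin m) :
    1 - (I j (vecMulVec (ψ j) (star (ψ j)))).trace.re ≤ measurementError Q I := by
  have hρ : IsDensity (vecMulVec (ψ j) (star (ψ j))) :=
    ⟨posSemidef_vecMulVec_self_star _, by rw [trace_vecMulVec, dotProduct_comm, hψ]⟩
  refine le_trans ?_ (sum_norm_trace_sub_le_measurementError hQ hI hρ)
  set p : Fin m → ℂ := fun i => (I i (vecMulVec (ψ j) (star (ψ j)))).trace with hp
  have hq (i : Fin m) : (Q i * vecMulVec (ψ j) (star (ψ j))).trace = if i = j then 1 else 0 := by
    rw [mul_vecMulVec, trace_vecMulVec, hQψ, dotProduct_comm]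
    split_ifs <;> simp [hψ]
  have hsum : ∑ i, (p i).re = 1 := by
    rw [← Complex.re_sum, hI.sum_trace, hρ.trace_eq_one, Complex.one_re]
  -- The distances are bounded below by `p i` for `i ≠ j` and by `1 - p j` for `i = j`.
  have h1 : ∑ i, ((p i).re + if i = j then 1 - 2 * (p i).re else 0) ≤
      ∑ i, ‖p i - (Q i * vecMulVec (ψ j) (star (ψ j))).trace‖ := by
    refine Finset.sum_le_sum fun i _ => ?_
    rw [hq]
    split_ifs
    · rw [norm_sub_rev]
      refine le_trans (le_of_eq ?_) (Complex.re_le_norm _)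
      simp; ring
    · refine le_trans (le_of_eq ?_) (Complex.re_le_norm _)
      simp
  rw [Finset.sum_add_distrib, hsum, Finset.sum_ite_eq' Finset.univ j] at h1
  simp only [Finset.mem_univ, if_true] at h1
  change 1 - (p j).re ≤ 1 / 2 * ∑ i, ‖p i - (Q i * vecMulVec (ψ j) (star (ψ j))).trace‖
  linarith

end MeasurementError

/-! ### The lower bound on the measurement error -/

section LowerBound

variable {d m : ℕ}

/-- Separate the diagonal of `y`, and apply the Cauchy-Schwarz inequality to the off-diagonal part
of each row, which has `m - 1` entries. -/
theorem sum_sq_sum_le (y : Fin m → Fin m → ℝ) :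
    ∑ i, (∑ a, y i a) ^ 2 ≤ (√(∑ i, y i i ^ 2) +
      √((m : ℝ) - 1) * √(∑ i, ∑ a ∈ Finset.univ.erase i, y i a ^ 2)) ^ 2 := by
  rcases Nat.eq_zero_or_pos m with rfl | hm
  · simp
  have hn : (0 : ℝ) ≤ (m : ℝ) - 1 := by
    have : (1 : ℝ) ≤ m := by exact_mod_cast hm
    linarith
  set r : Fin m → ℝ := fun i => ∑ a ∈ Finset.univ.erase i, y i a with hr
  set A := ∑ i, y i i ^ 2 with hA
  set B := ∑ i, ∑ a ∈ Finset.univ.erase i, y i a ^ 2 with hB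
  have hA0 : 0 ≤ A := Finset.sum_nonneg fun i _ => sq_nonneg _
  have hB0 : 0 ≤ B := Finset.sum_nonneg fun i _ => Finset.sum_nonneg fun a _ => sq_nonneg _
  have h1 (i : Fin m) : ∑ a, y i a = y i i + r i :=
    (Finset.add_sum_erase _ _ (Finset.mem_univ i)).symm
  have h2 : ∑ i, r i ^ 2 ≤ ((m : ℝ) - 1) * B := by
    rw [hB, Finset.mul_sum]
    refine Finset.sum_le_sum fun i _ => ?_
    refine sq_sum_le_card_mul_sum_sq.trans (le_of_eq ?_)
    rw [Finset.card_erase_of_mem (Finset.mem_univ i), Finset.card_univ, Fintype.card_fin,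
      Nat.cast_sub hm, Nat.cast_one]
  have h3 : ∑ i, y i i * r i ≤ √A * (√((m : ℝ) - 1) * √B) := by
    rw [← Real.sqrt_mul hn, ← Real.sqrt_mul hA0]
    refine Real.le_sqrt_of_sq_le ((Finset.sum_mul_sq_le_sq_mul_sq _ _ _).trans ?_)
    gcongr
  have h4 : ∑ i, (∑ a, y i a) ^ 2 = A + 2 * ∑ i, y i i * r i + ∑ i, r i ^ 2 := by
    rw [hA, Finset.mul_sum, ← Finset.sum_add_distrib, ← Finset.sum_add_distrib]
    refine Finset.sum_congr rfl fun i _ => ?_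
    rw [h1]; ring
  have h5 : (√A + √((m : ℝ) - 1) * √B) ^ 2 =
      A + 2 * (√A * (√((m : ℝ) - 1) * √B)) + ((m : ℝ) - 1) * B := by
    rw [add_sq, mul_pow, Real.sq_sqrt hA0, Real.sq_sqrt hB0, Real.sq_sqrt hn]; ring
  rw [h4, h5]
  linarith

/-- The real inequality behind the lower bound. With `x² + z² = m` split into diagonal and
off-diagonal mass of `y` and `n² = m - 1`, the vectors `(x, z)` and `(1, n)` satisfy
`(x + n z)² + (z - n x)² = m²`; a small disturbance forces `x + n z` to be large, hence `z - n x` to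
be small in absolute value and `z` to be bounded below. -/
theorem tradeoff_le_of_sum_sq (hm : 1 ≤ m) {y : Fin m → Fin m → ℝ}
    (hy : ∀ a, ∑ i, y i a ^ 2 = 1) {δ D : ℝ} (hδ : ∀ a, 1 - y a a ^ 2 ≤ δ) (hD : 0 ≤ D)
    (h : 2 * (1 - (∑ i, (∑ a, y i a) ^ 2) / m ^ 2) ≤ D) : tradeoff m D ≤ δ := by
  have hm1 : (1 : ℝ) ≤ m := by exact_mod_cast hm
  have hm0 : (0 : ℝ) < m := by linarith
  unfold tradeoff
  split_ifs with hDm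
  swap
  · -- Here the tradeoff function vanishes, and `1 - y a a ^ 2` is nonnegative for any `a`.
    refine le_trans ?_ (hδ ⟨0, hm⟩)
    rw [sub_nonneg, ← hy ⟨0, hm⟩]
    exact Finset.single_le_sum (f := fun i => y i ⟨0, hm⟩ ^ 2) (fun i _ => sq_nonneg _)
      (Finset.mem_univ _)
  set A := ∑ i, y i i ^ 2 with hA
  set B := ∑ i, ∑ a ∈ Finset.univ.erase i, y i a ^ 2 with hB
  have hA0 : 0 ≤ A := Finset.sum_nonneg fun i _ => sq_nonneg _
  have hB0 : 0 ≤ B := Finset.sum_nonneg fun i _ => Finset.sum_nonneg fun a _ => sq_nonneg _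
  have hAB : A + B = m := by
    rw [hA, hB, ← Finset.sum_add_distrib]
    rw [Finset.sum_congr rfl fun i _ =>
      Finset.add_sum_erase Finset.univ (fun a => y i a ^ 2) (Finset.mem_univ i), Finset.sum_comm]
    simp [hy]
  have hAδ : m * (1 - δ) ≤ A := by
    have : ∑ _i : Fin m, (1 - δ) ≤ A := Finset.sum_le_sum fun i _ => by linarith [hδ i]
    rwa [Finset.sum_const, Finset.card_univ, Fintype.card_fin, nsmul_eq_mul] at this
  have hkey := sum_sq_sum_le y
  rw [← hA, ← hB] at hkey
  set x := √A
  set z := √B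
  set n := √((m : ℝ) - 1)
  have hx0 : 0 ≤ x := Real.sqrt_nonneg _
  have hz0 : 0 ≤ z := Real.sqrt_nonneg _
  have hn0 : 0 ≤ n := Real.sqrt_nonneg _
  have hx : x ^ 2 = A := Real.sq_sqrt hA0
  have hz : z ^ 2 = B := Real.sq_sqrt hB0
  have hn : n ^ 2 = m - 1 := Real.sq_sqrt (by linarith)
  have hD2 : D ≤ 2 := by
    have : 0 < 2 / (m : ℝ) := by positivity
    linarith
  rw [Real.sqrt_mul (by linarith)]
  set p := √(2 - D)
  set q := √D
  have hp0 : 0 ≤ p := Real.sqrt_nonneg _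
  have hq0 : 0 ≤ q := Real.sqrt_nonneg _
  have hp : p ^ 2 = 2 - D := Real.sq_sqrt (by linarith)
  have hq : q ^ 2 = D := Real.sq_sqrt hD
  have hs : √2 ^ 2 = (2 : ℝ) := Real.sq_sqrt (by norm_num)
  have hs0 : 0 ≤ √2 := Real.sqrt_nonneg _
  have h1 : (m * p) ^ 2 ≤ (√2 * (x + n * z)) ^ 2 := by
    rw [mul_pow, mul_pow, hp, hs]
    have : (∑ i, (∑ a, y i a) ^ 2) / (m : ℝ) ^ 2 ≤ (x + n * z) ^ 2 / (m : ℝ) ^ 2 := by gcongr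
    have h' : 2 * (1 - (x + n * z) ^ 2 / (m : ℝ) ^ 2) ≤ D := by linarith
    have h'' : (x + n * z) ^ 2 / (m : ℝ) ^ 2 * m ^ 2 = (x + n * z) ^ 2 := by field_simp
    nlinarith [sq_nonneg (m : ℝ)]
  have h2 : m * p ≤ √2 * (x + n * z) := by
    exact (pow_le_pow_iff_left₀ (by positivity) (by positivity) two_ne_zero).mp h1
  have h3 : (x + n * z) ^ 2 + (z - n * x) ^ 2 = m ^ 2 := by
    calc _ = (1 + n ^ 2) * (x ^ 2 + z ^ 2) := by ring
      _ = _ := by rw [hn, hx, hz, hAB]; ring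
  have h4 : (√2 * (n * x - z)) ^ 2 ≤ (m * q) ^ 2 := by
    rw [mul_pow, mul_pow, hp, hs] at h1
    rw [mul_pow, mul_pow, hq, hs]
    nlinarith
  have h5 : √2 * (n * x - z) ≤ m * q := by
    exact le_trans (le_abs_self _) (abs_le_of_sq_le_sq h4 (by positivity))
  have h6 : n * p - q ≤ √2 * z := by
    have : m * (n * p - q) ≤ m * (√2 * z) := by
      have : n * (m * p) ≤ n * (√2 * (x + n * z)) := by gcongr
      have e : m * (√2 * z) = n * (√2 * (x + n * z)) - √2 * (n * x - z) := by
        have : (m : ℝ) = n ^ 2 + 1 := by linarith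
        rw [this]; ring
      rw [e]; linarith
    exact le_of_mul_le_mul_left this hm0
  have h7 : 0 ≤ n * p - q := by
    rw [sub_nonneg]
    refine (pow_le_pow_iff_left₀ hq0 (by positivity) two_ne_zero).mp ?_
    rw [mul_pow, hn, hp, hq]
    have : D * m ≤ (2 - 2 / m) * m := by gcongr
    have e : (2 - 2 / (m : ℝ)) * m = 2 * m - 2 := by field_simp
    linarith
  have h8 : (n * p - q) ^ 2 ≤ 2 * B := by
    rw [← hs, ← hz, ← mul_pow]
    gcongr
  rw [one_div, mul_comm p, inv_mul_le_iff₀ (by positivity)]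
  linarith

theorem tradeoff_disturbance_le_measurementError (hm : 1 ≤ m) {Q : Fin m → Mat d}
    (hQ : IsVonNeumannMeasurement Q) {I : Fin m → (Mat d →ₗ[ℂ] Mat d)} (hI : IsInstrument I) :
    tradeoff m (disturbance I) ≤ measurementError Q I := by
  obtain ⟨ψ, hψ, hQψ⟩ := hQ.exists_unit_vectors
  have hι : Function.Injective (Fin.castLE (le_of_mulVec_eq_ite hψ hQψ)) :=
    Fin.castLE_injective _
  have hps (i a) : 0 ≤ (I i (vecMulVec (ψ a) (star (ψ a)))).trace.re :=
    (Complex.le_def.mp ((hI.completelyPositive i).posSemidef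
      (posSemidef_vecMulVec_self_star (ψ a))).trace_nonneg).1
  refine tradeoff_le_of_sum_sq hm
    (y := fun i a => √(I i (vecMulVec (ψ a) (star (ψ a)))).trace.re) (fun a => ?_) (fun a => ?_)
    (diamondNorm_nonneg _) ?_
  · simp only [Real.sq_sqrt (hps _ _)]
    rw [← Complex.re_sum, hI.sum_trace, trace_vecMulVec, dotProduct_comm, hψ, Complex.one_re]
  · rw [Real.sq_sqrt (hps _ _)]
    exact one_sub_trace_le_measurementError hQ hI hψ hQψ a
  · refine le_trans ?_ (two_mul_one_sub_overlap_le hm hI.isCompletelyPositive_sum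
      hI.tracePreserving hψ hι)
    rw [overlap_sum]
    gcongr with i
    exact overlap_le (hI.completelyPositive i) hψ hι

end LowerBound

/-! ### Kraus operators mixing the measurement with the identity -/

section Tightness

variable {d m : ℕ} {Q : Fin m → Mat d}

theorem IsVonNeumannMeasurement.trace_conjMap (hQ : IsVonNeumannMeasurement Q) (i : Fin m)
    (X : Mat d) : (conjMap (Q i) X).trace = (Q i * X).trace := by
  rw [conjMap_apply, (hQ.posSemidef i).1.eq, trace_mul_comm, ← Matrix.mul_assoc,
    (hQ.isStarProjection i).isIdempotentElem.eq]

/-- The Lüders (dephasing) channel `X ↦ ∑ᵢ Qᵢ X Qᵢ` of a measurement `Q`. -/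
def luders (Q : Fin m → Mat d) : Mat d →ₗ[ℂ] Mat d := ∑ i, conjMap (Q i)

theorem IsVonNeumannMeasurement.trace_luders (hQ : IsVonNeumannMeasurement Q) (X : Mat d) :
    (luders Q X).trace = X.trace := by
  rw [luders, LinearMap.sum_apply, trace_sum, ← hQ.sum_trace_mul X]
  exact Finset.sum_congr rfl fun i _ => hQ.trace_conjMap i X

theorem IsVonNeumannMeasurement.tensorId_luders_sub (hQ : IsVonNeumannMeasurement Q) (hm : 1 ≤ m)
    {k : ℕ} {X : Matrix (Fin d × Fin k) (Fin d × Fin k) ℂ} (hX : X.PosSemidef) :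
    (tensorId (luders Q) k X - ((1 / m : ℝ) : ℂ) • X).PosSemidef := by
  simp only [luders, tensorId_sum_apply, tensorId_conjMap]
  refine posSemidef_pinching_sub hm hX (fun i => Q i ⊗ₖ (1 : Mat k)) ?_
  have h : ∑ i, Q i ⊗ₖ (1 : Mat k) = (∑ i, Q i) ⊗ₖ (1 : Mat k) := by
    ext p q
    simp [Matrix.sum_apply, kroneckerMap_apply, Finset.sum_mul]
  rw [h, hQ.sum_eq_one, one_kronecker_one]

theorem overlap_luders {ψ : Fin m → Fin d → ℂ} (hψ : ∀ a, star (ψ a) ⬝ᵥ ψ a = 1)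
    (hQψ : ∀ i a, Q i *ᵥ ψ a = if i = a then ψ a else 0) {k : ℕ} {ι : Fin m → Fin k}
    (hι : Function.Injective ι) : overlap ψ ι (luders Q) = m := by
  simp [luders, overlap_sum, overlap_conjMap ψ hι, hQψ, apply_ite, hψ]

theorem overlap_id {ψ : Fin m → Fin d → ℂ} (hψ : ∀ a, star (ψ a) ⬝ᵥ ψ a = 1)
    {k : ℕ} {ι : Fin m → Fin k} (hι : Function.Injective ι) :
    overlap ψ ι LinearMap.id = m ^ 2 := by
  have h : (LinearMap.id : Mat d →ₗ[ℂ] Mat d) = conjMap 1 := by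
    ext X : 1
    simp [conjMap_apply]
  rw [h, overlap_conjMap ψ hι]
  simp [hψ]

/-- The two bounds on the disturbance coincide if `Φ - p id` is positive on `ℂ^d ⊗ ℂ^d` and the
overlap of `Φ` equals that of `p id`. -/
theorem disturbance_eq (hm : 1 ≤ m) {I : Fin m → (Mat d →ₗ[ℂ] Mat d)} (hI : IsInstrument I)
    {p : ℝ} (hp : p ≤ 1)
    (h : ∀ X : Matrix (Fin d × Fin d) (Fin d × Fin d) ℂ, X.PosSemidef →
      (tensorId (∑ i, I i) d X - (p : ℂ) • X).PosSemidef)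
    {ψ : Fin m → Fin d → ℂ} (hψ : ∀ a, star (ψ a) ⬝ᵥ ψ a = 1)
    {ι : Fin m → Fin d} (hι : Function.Injective ι) (hov : overlap ψ ι (∑ i, I i) = p * m ^ 2) :
    disturbance I = 2 * (1 - p) := by
  have hm0 : (m : ℝ) ^ 2 ≠ 0 := by
    have : (m : ℝ) ≠ 0 := by exact_mod_cast (by lia : m ≠ 0)
    positivity
  refine le_antisymm (diamondNorm_sub_id_le hI.tracePreserving hp h) ?_
  have := two_mul_one_sub_overlap_le hm hI.isCompletelyPositive_sum hI.tracePreserving hψ hι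
  rwa [hov, mul_div_assoc, div_self hm0, mul_one] at this

/-- The Kraus operator `a Qᵢ + b 𝟙`. -/
def mixKraus (Q : Fin m → Mat d) (a b : ℝ) (i : Fin m) : Mat d := (a : ℂ) • Q i + (b : ℂ) • 1

theorem IsVonNeumannMeasurement.conjTranspose_mixKraus (hQ : IsVonNeumannMeasurement Q) (a b : ℝ)
    (i : Fin m) : (mixKraus Q a b i)ᴴ = mixKraus Q a b i := by
  simp [mixKraus, conjTranspose_add, conjTranspose_smul, (hQ.posSemidef i).1.eq]

theorem IsVonNeumannMeasurement.conjMap_mixKraus (hQ : IsVonNeumannMeasurement Q) (a b : ℝ)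
    (i : Fin m) (X : Mat d) : conjMap (mixKraus Q a b i) X = ((a ^ 2 : ℝ) : ℂ) • conjMap (Q i) X +
      ((a * b : ℝ) : ℂ) • (Q i * X + X * Q i) + ((b ^ 2 : ℝ) : ℂ) • X := by
  rw [conjMap_apply, hQ.conjTranspose_mixKraus, conjMap_apply, (hQ.posSemidef i).1.eq, mixKraus]
  simp only [Matrix.add_mul, Matrix.mul_add, Matrix.smul_mul, Matrix.mul_smul, Matrix.one_mul,
    Matrix.mul_one]
  push_cast
  module

theorem IsVonNeumannMeasurement.sum_conjMap_mixKraus (hQ : IsVonNeumannMeasurement Q) {a b : ℝ}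
    (hab : a ^ 2 + 2 * a * b + m * b ^ 2 = 1) :
    ∑ i, conjMap (mixKraus Q a b i) =
      ((a ^ 2 : ℝ) : ℂ) • luders Q + ((1 - a ^ 2 : ℝ) : ℂ) • LinearMap.id := by
  ext X : 1
  have h : (1 - a ^ 2 : ℝ) = 2 * (a * b) + m * b ^ 2 := by linarith
  simp only [LinearMap.sum_apply, hQ.conjMap_mixKraus, Finset.sum_add_distrib, ← Finset.smul_sum,
    ← Matrix.sum_mul, ← Matrix.mul_sum, hQ.sum_eq_one, LinearMap.add_apply, LinearMap.smul_apply,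
    luders, LinearMap.id_apply, h, Finset.sum_const, Finset.card_univ, Fintype.card_fin]
  push_cast
  rw [Matrix.one_mul, Matrix.mul_one]
  module

theorem IsVonNeumannMeasurement.isInstrument_mixKraus (hQ : IsVonNeumannMeasurement Q) {a b : ℝ}
    (hab : a ^ 2 + 2 * a * b + m * b ^ 2 = 1) :
    IsInstrument fun i => conjMap (mixKraus Q a b i) where
  completelyPositive i := isCompletelyPositive_conjMap _
  tracePreserving X := by
    rw [hQ.sum_conjMap_mixKraus hab, LinearMap.add_apply, LinearMap.smul_apply,
      LinearMap.smul_apply, trace_add, trace_smul, trace_smul, hQ.trace_luders]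
    simp
    ring

theorem IsVonNeumannMeasurement.disturbance_mixKraus (hQ : IsVonNeumannMeasurement Q) (hm : 1 ≤ m)
    {a b : ℝ} (hab : a ^ 2 + 2 * a * b + m * b ^ 2 = 1) :
    disturbance (fun i => conjMap (mixKraus Q a b i)) = 2 * (a ^ 2 * (1 - 1 / m)) := by
  obtain ⟨ψ, hψ, hQψ⟩ := hQ.exists_unit_vectors
  have hι : Function.Injective (Fin.castLE (le_of_mulVec_eq_ite hψ hQψ)) :=
    Fin.castLE_injective _
  have hm1 : (1 : ℝ) ≤ m := by exact_mod_cast hm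
  have hm2 : 1 / (m : ℝ) ≤ 1 := by rw [div_le_one (by linarith)]; exact hm1
  have h := disturbance_eq hm (hQ.isInstrument_mixKraus hab) (p := 1 - a ^ 2 * (1 - 1 / m))
    (by nlinarith [sq_nonneg a]) (fun X hX => ?_) hψ hι ?_
  · rw [h]; ring
  · rw [hQ.sum_conjMap_mixKraus hab, tensorId_add_apply, tensorId_smul_apply, tensorId_smul_apply]
    have := (hQ.tensorId_luders_sub hm hX).smul (Complex.zero_le_real.mpr (sq_nonneg a))
    convert this using 1
    change _ + _ • X - _ = _
    push_cast
    module
  · rw [hQ.sum_conjMap_mixKraus hab, overlap_add, overlap_smul, overlap_smul,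
      overlap_luders hψ hQψ hι, overlap_id hψ hι]
    field_simp
    ring

/-- The implemented outcome probability exceeds `qᵢ = tr (Qᵢ ρ)` by exactly `b² (1 - m qᵢ)`. -/
theorem IsVonNeumannMeasurement.measurementError_mixKraus_le (hQ : IsVonNeumannMeasurement Q)
    (hm : 1 ≤ m) {a b : ℝ} (hab : a ^ 2 + 2 * a * b + m * b ^ 2 = 1) :
    measurementError Q (fun i => conjMap (mixKraus Q a b i)) ≤ ((m : ℝ) - 1) * b ^ 2 := by
  have hm1 : (1 : ℝ) ≤ m := by exact_mod_cast hm
  refine measurementError_le (hQ.isInstrument_mixKraus hab)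
    (mul_nonneg (by linarith) (sq_nonneg b)) fun ρ hρ => ?_
  set q : Fin m → ℝ := fun i => (Q i * ρ).trace.re with hq
  have hqC (i) : (Q i * ρ).trace = (q i : ℂ) :=
    Complex.ext rfl
      (by simpa using (Complex.le_def.mp (hQ.trace_mul_nonneg i hρ.posSemidef)).2.symm)
  have hq0 (i) : 0 ≤ q i := (Complex.le_def.mp (hQ.trace_mul_nonneg i hρ.posSemidef)).1
  have hq1 : ∑ i, q i = 1 := by
    rw [← Complex.re_sum, hQ.sum_trace_mul, hρ.trace_eq_one, Complex.one_re]
  have hterm (i) : ‖(conjMap (mixKraus Q a b i) ρ).trace - (Q i * ρ).trace‖ ≤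
      b ^ 2 * (1 + ((m : ℝ) - 2) * q i) := by
    have e : (conjMap (mixKraus Q a b i) ρ).trace - (Q i * ρ).trace =
        ((b ^ 2 * (1 - m * q i) : ℝ) : ℂ) := by
      rw [hQ.conjMap_mixKraus, trace_add, trace_add, trace_smul, trace_smul, trace_smul, trace_add,
        trace_mul_comm ρ, hQ.trace_conjMap, hqC, hρ.trace_eq_one]
      simp only [smul_eq_mul]
      norm_cast
      linear_combination q i * hab
    rw [e, Complex.norm_real, Real.norm_eq_abs, abs_mul, abs_of_nonneg (sq_nonneg b)]
    have hle : q i ≤ 1 := hq1 ▸ Finset.single_le_sum (fun i _ => hq0 i) (Finset.mem_univ i)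
    gcongr
    rw [abs_le]
    constructor <;> nlinarith [hq0 i]
  refine (mul_le_mul_of_nonneg_left (Finset.sum_le_sum fun i _ => hterm i)
    (by norm_num)).trans (le_of_eq ?_)
  rw [← Finset.mul_sum, Finset.sum_add_distrib, ← Finset.mul_sum, hq1]
  simp
  ring

/-- Coefficients realising a prescribed disturbance up to `2 - 2 / m`:
`a² = m D / (2 (m - 1))`, and `b` is the larger root of the normalisation condition. -/
theorem exists_mixing_coefficients (hm : 1 ≤ m) {D : ℝ} (hD : 0 ≤ D) (hDm : D ≤ 2 - 2 / m) :
    ∃ a b : ℝ, a ^ 2 + 2 * a * b + m * b ^ 2 = 1 ∧ 2 * (a ^ 2 * (1 - 1 / m)) = D ∧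
      ((m : ℝ) - 1) * b ^ 2 = tradeoff m D := by
  rw [tradeoff, if_pos hDm]
  rcases hm.eq_or_lt with rfl | hm
  · have : D = 0 := by norm_num at hDm; linarith
    -- A single outcome leaves only `D = 0`, where the formulas for `a` and `b` divide by zero.
    exact ⟨0, 1, by simp [this]⟩
  have hm1 : (1 : ℝ) < m := by exact_mod_cast hm
  have hm0 : (0 : ℝ) < m := by linarith
  have hn0 : (m : ℝ) - 1 ≠ 0 := by linarith
  have hD2 : D ≤ 2 := by
    have : 0 < 2 / (m : ℝ) := by positivity
    linarith
  rw [Real.sqrt_mul (by linarith)]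
  set n := √((m : ℝ) - 1)
  set p := √(2 - D)
  set q := √D
  set r := √(2 * (m : ℝ))
  have hn : n ^ 2 = m - 1 := Real.sq_sqrt (by linarith)
  have hp : p ^ 2 = 2 - D := Real.sq_sqrt (by linarith)
  have hq : q ^ 2 = D := Real.sq_sqrt hD
  have hr : r ^ 2 = 2 * m := Real.sq_sqrt (by linarith)
  have hr0 : r ≠ 0 := (Real.sqrt_pos.mpr (by linarith)).ne'
  have hnn : n ≠ 0 := (Real.sqrt_pos.mpr (by linarith)).ne'
  have ha : (m * q / (r * n)) ^ 2 = m * D / (2 * (m - 1)) := by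
    rw [div_pow, mul_pow, mul_pow, hq, hr, hn]
    field_simp
  have hb : ((p * n - q) / (r * n)) ^ 2 = (p * n - q) ^ 2 / (2 * m * (m - 1)) := by
    rw [div_pow, mul_pow, hr, hn]
  refine ⟨m * q / (r * n), (p * n - q) / (r * n), ?_, ?_, ?_⟩
  · have : m * q / (r * n) * ((p * n - q) / (r * n)) = m * q * (p * n - q) / (2 * m * (m - 1)) := by
      rw [div_mul_div_comm, mul_mul_mul_comm, ← sq, ← sq, hr, hn]
    rw [ha, hb, mul_assoc, this]
    field_simp
    linear_combination n ^ 2 * hp + (2 - D) * hn - hq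
  · rw [ha]
    field_simp
  · rw [hb]
    field_simp

end Tightness

/-! ### Error-free measurements with large disturbance -/

section Sharp

variable {d m : ℕ} {Q : Fin m → Mat d}

/-- The instrument that measures `Q` and then, with probability `t`, applies the isometry `Wᵢ`
depending on the outcome `i`. -/
def measureThenRotate (Q W : Fin m → Mat d) (t : ℝ) (i : Fin m) : Mat d →ₗ[ℂ] Mat d :=
  ((1 - t : ℝ) : ℂ) • conjMap (Q i) + (t : ℂ) • conjMap (W i * Q i)

variable {W : Fin m → Mat d} {t : ℝ}

theorem IsVonNeumannMeasurement.trace_measureThenRotate (hQ : IsVonNeumannMeasurement Q)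
    (hW : ∀ i, (W i)ᴴ * W i = 1) (i : Fin m) (X : Mat d) :
    (measureThenRotate Q W t i X).trace = (Q i * X).trace := by
  have h : (conjMap (W i * Q i) X).trace = (conjMap (Q i) X).trace := by
    rw [conjMap_apply, conjTranspose_mul, trace_mul_comm, Matrix.mul_assoc,
      ← Matrix.mul_assoc (W i)ᴴ,
      ← Matrix.mul_assoc (W i)ᴴ, hW, Matrix.one_mul, trace_mul_comm, conjMap_apply]
  rw [measureThenRotate, LinearMap.add_apply, LinearMap.smul_apply, LinearMap.smul_apply, trace_add,
    trace_smul, trace_smul, h, ← add_smul, hQ.trace_conjMap]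
  push_cast
  rw [sub_add_cancel, one_smul]

theorem sum_measureThenRotate : ∑ i, measureThenRotate Q W t i =
    ((1 - t : ℝ) : ℂ) • luders Q + (t : ℂ) • ∑ i, conjMap (W i * Q i) := by
  simp only [measureThenRotate, Finset.sum_add_distrib, ← Finset.smul_sum, luders]

theorem IsVonNeumannMeasurement.isInstrument_measureThenRotate (hQ : IsVonNeumannMeasurement Q)
    (hW : ∀ i, (W i)ᴴ * W i = 1) (ht0 : 0 ≤ t) (ht1 : t ≤ 1) :
    IsInstrument (measureThenRotate Q W t) where
  completelyPositive i := ((isCompletelyPositive_conjMap _).smul (sub_nonneg.mpr ht1)).add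
    ((isCompletelyPositive_conjMap _).smul ht0)
  tracePreserving X := by
    simp only [LinearMap.sum_apply, trace_sum, hQ.trace_measureThenRotate hW, hQ.sum_trace_mul]

theorem IsVonNeumannMeasurement.disturbance_measureThenRotate (hQ : IsVonNeumannMeasurement Q)
    (hm : 1 ≤ m) (hW : ∀ i, (W i)ᴴ * W i = 1) (ht0 : 0 ≤ t) (ht1 : t ≤ 1) {ψ : Fin m → Fin d → ℂ}
    (hψ : ∀ a, star (ψ a) ⬝ᵥ ψ a = 1) (hQψ : ∀ i a, Q i *ᵥ ψ a = if i = a then ψ a else 0)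
    (hWψ : ∀ a, star (ψ a) ⬝ᵥ W a *ᵥ ψ a = 0) :
    disturbance (measureThenRotate Q W t) = 2 * (1 - (1 - t) / m) := by
  have hι : Function.Injective (Fin.castLE (le_of_mulVec_eq_ite hψ hQψ)) :=
    Fin.castLE_injective _
  have hm1 : (1 : ℝ) ≤ m := by exact_mod_cast hm
  refine disturbance_eq hm (hQ.isInstrument_measureThenRotate hW ht0 ht1) ?_ (fun X hX => ?_)
    hψ hι ?_
  · rw [div_le_one (by linarith)]
    linarith
  · rw [sum_measureThenRotate, tensorId_add_apply, tensorId_smul_apply, tensorId_smul_apply,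
      tensorId_sum_apply]
    have h1 := (hQ.tensorId_luders_sub hm hX).smul (Complex.zero_le_real.mpr (sub_nonneg.mpr ht1))
    have h2 := (posSemidef_sum Finset.univ fun i _ =>
      isCompletelyPositive_conjMap (W i * Q i) d X hX).smul (Complex.zero_le_real.mpr ht0)
    convert h1.add h2 using 1
    push_cast
    module
  · have h (i : Fin m) : overlap ψ (Fin.castLE (le_of_mulVec_eq_ite hψ hQψ))
        (conjMap (W i * Q i)) = 0 := by
      rw [overlap_conjMap ψ hι]
      simp [← mulVec_mulVec, hQψ, apply_ite, hWψ]
    rw [sum_measureThenRotate, overlap_add, overlap_smul, overlap_smul, overlap_luders hψ hQψ hι,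
      overlap_sum]
    simp only [h, Finset.sum_const_zero, mul_zero, add_zero]
    field_simp

theorem IsVonNeumannMeasurement.measurementError_measureThenRotate_le
    (hQ : IsVonNeumannMeasurement Q) (hW : ∀ i, (W i)ᴴ * W i = 1) (ht0 : 0 ≤ t) (ht1 : t ≤ 1) :
    measurementError Q (measureThenRotate Q W t) ≤ 0 := by
  refine measurementError_le (hQ.isInstrument_measureThenRotate hW ht0 ht1) le_rfl fun ρ _ => ?_
  simp [hQ.trace_measureThenRotate hW]

theorem exists_instrument_of_disturbance (hm : 1 ≤ m) (hQ : IsVonNeumannMeasurement Q) {D : ℝ}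
    (hD0 : 0 ≤ D) (hD2 : D ≤ 2) (hd : d = 1 → D = 0) :
    ∃ I : Fin m → (Mat d →ₗ[ℂ] Mat d), IsInstrument I ∧ disturbance I = D ∧
      measurementError Q I = tradeoff m D := by
  suffices ∃ I : Fin m → (Mat d →ₗ[ℂ] Mat d), IsInstrument I ∧ disturbance I = D ∧
      measurementError Q I ≤ tradeoff m D by
    obtain ⟨I, hI, hID, hle⟩ := this
    refine ⟨I, hI, hID, le_antisymm hle ?_⟩
    rw [← hID]
    exact tradeoff_disturbance_le_measurementError hm hQ hI
  by_cases hDm : D ≤ 2 - 2 / m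
  · obtain ⟨a, b, hab, hD, hτ⟩ := exists_mixing_coefficients hm hD0 hDm
    exact ⟨_, hQ.isInstrument_mixKraus hab, (hQ.disturbance_mixKraus hm hab).trans hD,
      hτ ▸ hQ.measurementError_mixKraus_le hm hab⟩
  · obtain ⟨ψ, hψ, hQψ⟩ := hQ.exists_unit_vectors
    have hmd := le_of_mulVec_eq_ite hψ hQψ
    have hm1 : (1 : ℝ) ≤ m := by exact_mod_cast hm
    have hm0 : (0 : ℝ) < m := by linarith
    have hDm' : 2 - 2 / (m : ℝ) < D := not_le.mp hDm
    have hd2 : 2 ≤ d := by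
      by_contra hlt
      have hle : 2 / (m : ℝ) ≤ 2 := div_le_self (by norm_num) hm1
      have := hd (by lia)
      linarith
    choose W hW hWψ using fun a => exists_isometry_dotProduct_eq_zero hd2 (hψ a)
    -- `t` solves `2 * (1 - (1 - t) / m) = D`.
    have ht0 : 0 ≤ 1 - m * (1 - D / 2) := by
      have h : (2 - 2 / (m : ℝ)) * m < D * m := by gcongr
      have e : (2 - 2 / (m : ℝ)) * m = 2 * m - 2 := by field_simp
      linarith
    have ht1 : 1 - m * (1 - D / 2) ≤ 1 := by
      have := mul_nonneg hm0.le (by linarith : 0 ≤ 1 - D / 2)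
      linarith
    refine ⟨_, hQ.isInstrument_measureThenRotate hW ht0 ht1, ?_, ?_⟩
    · rw [hQ.disturbance_measureThenRotate hm hW ht0 ht1 hψ hQψ hWψ]
      field_simp
      ring
    · rw [tradeoff, if_neg hDm]
      exact hQ.measurementError_measureThenRotate_le hW ht0 ht1

end Sharp

end QTradeoff

end

theorem theorem5p6 {d m : ℕ} (hm : 1 ≤ m) (Q : Fin m → QTradeoff.Mat d)
    (hQ : QTradeoff.IsVonNeumannMeasurement Q) :
    (∀ I : Fin m → (QTradeoff.Mat d →ₗ[ℂ] QTradeoff.Mat d), QTradeoff.IsInstrument I →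
      QTradeoff.tradeoff m (QTradeoff.disturbance I) ≤ QTradeoff.measurementError Q I) ∧
    (∀ D : ℝ, 0 ≤ D → D ≤ 2 → (d = 1 → D = 0) →
      ∃ I : Fin m → (QTradeoff.Mat d →ₗ[ℂ] QTradeoff.Mat d), QTradeoff.IsInstrument I ∧
        QTradeoff.disturbance I = D ∧
        QTradeoff.measurementError Q I = QTradeoff.tradeoff m D) :=
  ⟨fun _ hI => QTradeoff.tradeoff_disturbance_le_measurementError hm hQ hI,
    fun _ hD0 hD2 hd => QTradeoff.exists_instrument_of_disturbance hm hQ hD0 hD2 hd⟩
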